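/- For a polynomial $P\in\mathbb{C}[x_1,\dots,x_n]$ let $$m(P)=\frac{1}{(2\pi i)^n}\int_{|x_1|=\cdots=|x_n|=1}\log|P(x_1,\dots,x_n)|\,\frac{dx_1}{x_1}\cdots\frac{dx_n}{x_n}$$ be its logarithmic Mahler measure, and let $D$ be the Bloch--Wigner dilogarithm, $$D(z)=\mathrm{Im}(\mathrm{Li}_2(z))+\log|z|\,\arg(1-z)\qquad(z\in\mathbb{C}\setminus[1,\infty)),$$ extended by $0$ to $[1,\infty)$, where $\mathrm{Li}_2(z)=-\int_0^1\log(1-tz)\,\frac{dt}{t}$ and $\log$, $\arg$ are the principal branches. If $P(x,y)=y^2+y(x+1)+x^2+x+1$ and $\omega=e^{2\pi i/3}$, then the integral defining $m(P)$ converges absolutely and $$\pi\,m(P)=2D(i)-\tfrac34 D(\omega).$$ -/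

import Mathlib

open MeasureTheory

noncomputable section

/-- The real-valued function `θ ↦ log |P(e^{iθ₁}, …, e^{iθₙ})|`: the function `log |P|` on the torus
`|x₁| = ⋯ = |xₙ| = 1`, in the angular coordinates `xⱼ = e^{iθⱼ}`. -/
def logNormOnTorus {n : ℕ} (P : MvPolynomial (Fin n) ℂ) (θ : Fin n → ℝ) : ℝ :=
  Real.log ‖MvPolynomial.eval (fun j => Complex.exp (θ j * Complex.I)) P‖

/-- The cube `[0, 2π]ⁿ` of angles, which parametrizes the torus `|x₁| = ⋯ = |xₙ| = 1`. -/
def angleCube (n : ℕ) : Set (Fin n → ℝ) :=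
  Set.Icc (fun _ => 0) (fun _ => 2 * Real.pi)

/-- The logarithmic Mahler measure
`m(P) = (2πi)⁻ⁿ ∫_{|x₁| = ⋯ = |xₙ| = 1} log |P(x₁, …, xₙ)| dx₁/x₁ ⋯ dxₙ/xₙ`,
written in angular coordinates, where `dxⱼ/(2πi xⱼ) = dθⱼ/(2π)`. The next theorem is the formula
with the complex torus integral. -/
def logMahlerMeasure {n : ℕ} (P : MvPolynomial (Fin n) ℂ) : ℝ :=
  (2 * Real.pi)⁻¹ ^ n * ∫ θ in angleCube n, logNormOnTorus P θ

theorem logMahlerMeasure_eq_torusIntegral {n : ℕ} (P : MvPolynomial (Fin n) ℂ) :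
    (logMahlerMeasure P : ℂ) =
      (1 / (2 * Real.pi * Complex.I) ^ n) *
        torusIntegral (fun x => (Real.log ‖MvPolynomial.eval x P‖ : ℂ) * ∏ j, (x j)⁻¹)
          (fun _ => 0) (fun _ => 1) := by
  have h : torusIntegral (fun x => (Real.log ‖MvPolynomial.eval x P‖ : ℂ) * ∏ j, (x j)⁻¹)
      (fun _ => 0) (fun _ => 1) =
      ∫ θ in angleCube n, Complex.I ^ n * (logNormOnTorus P θ : ℂ) := by
    unfold torusIntegral angleCube
    congr 1
    funext θ
    have h1 : (∏ j, Complex.exp (θ j * Complex.I)) * ∏ j, (Complex.exp (θ j * Complex.I))⁻¹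
        = 1 := by
      rw [← Finset.prod_mul_distrib]
      exact Finset.prod_eq_one fun j _ => mul_inv_cancel₀ (Complex.exp_ne_zero _)
    have h2 : torusMap (fun _ => 0) (fun _ => 1) θ
        = fun j => Complex.exp (θ j * Complex.I) := by
      funext j
      simp [torusMap]
    simp only [h2, Complex.ofReal_one, one_mul, smul_eq_mul, logNormOnTorus,
      Finset.prod_mul_distrib, Finset.prod_const, Finset.card_univ, Fintype.card_fin]
    linear_combination (Complex.I ^ n * (Real.log ‖MvPolynomial.eval
      (fun j => Complex.exp (θ j * Complex.I)) P‖ : ℂ)) * h1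
  rw [h, integral_const_mul, integral_complex_ofReal, logMahlerMeasure]
  rw [mul_pow, mul_pow, inv_pow, mul_pow]
  push_cast
  have hI : Complex.I ^ n ≠ 0 := pow_ne_zero _ Complex.I_ne_zero
  have hpi : (Real.pi : ℂ) ^ n ≠ 0 := pow_ne_zero _ (by exact_mod_cast Real.pi_ne_zero)
  have h2 : (2 : ℂ) ^ n ≠ 0 := pow_ne_zero _ two_ne_zero
  field_simp

/-- The principal branch of the dilogarithm `Li₂(z) = -∫₀¹ log(1 - t z) dt / t`, for
`z ∈ ℂ \ [1, ∞)`; on the open unit disc it is `∑ zᵏ / k²`. -/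
def dilog (z : ℂ) : ℂ :=
  -∫ t in (0 : ℝ)..1, Complex.log (1 - t * z) / t

open Classical in
/-- The Bloch–Wigner dilogarithm: `D(z) = Im Li₂(z) + log |z| arg(1 - z)` for
`z ∈ ℂ \ [1, ∞)`, extended by `0` to `[1, ∞)`. -/
def blochWigner (z : ℂ) : ℝ :=
  if z.im = 0 ∧ 1 ≤ z.re then 0
  else (dilog z).im + Real.log ‖z‖ * (1 - z).arg

end

/-! Write L for `logTwoSinIntegral`. Both sides reduce to values of L.

On the dilogarithm side, differentiating Li₂ along the unit circle gives D(e^{iθ}) = -2 L(θ/2) for 0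
< θ < π, so D(i) = -2 L(π/4) and D(ω) = -2 L(π/3).

On the Mahler side, P is monic in y, so Jensen's formula turns the y-integral into log⁺ of the
moduli of the two roots. Putting x = e^{2iφ}, y = e^{iφ} Y makes the quadratic real: Y² + 2 cos φ ·
Y + 4 cos² φ - 1. By symmetry φ ∈ [0, π/2] suffices. Up to π/4 neither root is inside the unit disc
and the contribution is log(4 cos² φ - 1) = log(sin 3φ / sin φ); from π/4 to π/3 it is zero; from
π/3 on only one root counts, giving log(cos φ + √(1 - 3 cos² φ)).

The last integral is the hard one (`integral_log_sin_add_sqrt`). A rational parameter r removes the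
square root and splits the angle as a difference of two arctangents; the logarithm becomes a sum of
terms log(2 sin) of either arctangent, hence has a primitive built from L. The duplication and
triplication formulas for L then eliminate the values at π/12, 5π/12 and π/6. -/

/-! ### Functional equations of the Lobachevsky function. -/

/-- The integral `∫₀ˣ log |2 sin t| dt`, the negative of the Lobachevsky function. -/
noncomputable def logTwoSinIntegral (x : ℝ) : ℝ :=
  ∫ t in (0 : ℝ)..x, Real.log (2 * Real.sin t)

/-- `Real.log` is log |·|, and the logarithm of a meromorphic function has only integrable
singularities, so no restriction on the interval is needed. -/
theorem intervalIntegrable_log_two_sin (a b : ℝ) :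
    IntervalIntegrable (fun t => Real.log (2 * Real.sin t)) volume a b := by
  have h : MeromorphicOn (fun t : ℝ => 2 * Real.sin t) (Set.uIcc a b) := fun x _ => by
    have := (analyticAt_const (v := (2 : ℝ)) (x := x)).mul (Real.analyticAt_sin (x := x))
    exact this.meromorphicAt
  exact h.intervalIntegrable_log

theorem integral_log_two_sin (a b : ℝ) :
    ∫ t in a..b, Real.log (2 * Real.sin t) = logTwoSinIntegral b - logTwoSinIntegral a :=
  (intervalIntegral.integral_interval_sub_left (intervalIntegrable_log_two_sin _ _)
    (intervalIntegrable_log_two_sin _ _)).symm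

theorem ae_sin_mul_ne_zero {c : ℝ} (hc : c ≠ 0) : ∀ᵐ t : ℝ, Real.sin (c * t) ≠ 0 := by
  have h : Set.Countable {t : ℝ | Real.sin (c * t) = 0} := by
    refine (Set.countable_range (fun n : ℤ => (n : ℝ) * Real.pi / c)).mono ?_
    intro t ht
    obtain ⟨n, hn⟩ := Real.sin_eq_zero_iff.1 ht
    exact ⟨n, by field_simp; linarith⟩
  filter_upwards [h.ae_notMem volume] with t ht using ht

theorem continuous_logTwoSinIntegral : Continuous logTwoSinIntegral :=
  intervalIntegral.continuous_primitive intervalIntegrable_log_two_sin 0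

theorem hasDerivAt_logTwoSinIntegral {x : ℝ} (hx : Real.sin x ≠ 0) :
    HasDerivAt logTwoSinIntegral (Real.log (2 * Real.sin x)) x := by
  refine intervalIntegral.integral_hasDerivAt_right (intervalIntegrable_log_two_sin _ _) ?_ ?_
  · exact (Measurable.stronglyMeasurable (by fun_prop)).stronglyMeasurableAtFilter
  · exact (by fun_prop : ContinuousAt (fun t => 2 * Real.sin t) x).log (by simpa using hx)

@[simp]
theorem logTwoSinIntegral_zero : logTwoSinIntegral 0 = 0 := by simp [logTwoSinIntegral]

theorem log_two_sin_ae_eq :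
    (fun t : ℝ => Real.log (2 * Real.sin t)) =ᵐ[volume]
      fun t => Real.log 2 + Real.log (Real.sin t) := by
  filter_upwards [ae_sin_mul_ne_zero one_ne_zero] with t ht
  rw [one_mul] at ht
  rw [Real.log_mul two_ne_zero ht]

theorem logTwoSinIntegral_eq (x : ℝ) :
    logTwoSinIntegral x = x * Real.log 2 + ∫ t in (0 : ℝ)..x, Real.log (Real.sin t) := by
  rw [logTwoSinIntegral, intervalIntegral.integral_congr_ae' (log_two_sin_ae_eq.mono fun _ h _ => h)
    (log_two_sin_ae_eq.mono fun _ h _ => h), intervalIntegral.integral_add intervalIntegrable_const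
      (by exact intervalIntegrable_log_sin)]
  simp

@[simp]
theorem logTwoSinIntegral_pi_div_two : logTwoSinIntegral (Real.pi / 2) = 0 := by
  rw [logTwoSinIntegral_eq, integral_log_sin_zero_pi_div_two]
  ring

@[simp]
theorem logTwoSinIntegral_pi : logTwoSinIntegral Real.pi = 0 := by
  rw [logTwoSinIntegral_eq, integral_log_sin_zero_pi]
  ring

theorem logTwoSinIntegral_pi_sub (x : ℝ) :
    logTwoSinIntegral (Real.pi - x) = -logTwoSinIntegral x := by
  have h := intervalIntegral.integral_comp_sub_left (a := 0) (b := x)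
    (fun t => Real.log (2 * Real.sin t)) Real.pi
  simp only [Real.sin_pi_sub, sub_zero] at h
  rw [integral_log_two_sin, integral_log_two_sin] at h
  simp at h
  linarith

/-- Integrated form of 2 sin 2t = (2 sin t)(2 sin(t + π/2)); the constant L(π/2) vanishes. -/
theorem logTwoSinIntegral_two_mul (x : ℝ) :
    logTwoSinIntegral (2 * x) =
      2 * (logTwoSinIntegral x + logTwoSinIntegral (x + Real.pi / 2)) := by
  have h := intervalIntegral.integral_comp_mul_left (a := 0) (b := x)
    (fun t => Real.log (2 * Real.sin t)) (two_ne_zero (α := ℝ))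
  have h2 := intervalIntegral.integral_comp_add_right (a := 0) (b := x)
    (fun t => Real.log (2 * Real.sin t)) (Real.pi / 2)
  have hae : ∀ᵐ t : ℝ, Real.log (2 * Real.sin (2 * t)) =
      Real.log (2 * Real.sin t) + Real.log (2 * Real.sin (t + Real.pi / 2)) := by
    filter_upwards [ae_sin_mul_ne_zero two_ne_zero] with t ht
    have hk : 2 * Real.sin (2 * t) = 2 * Real.sin t * (2 * Real.sin (t + Real.pi / 2)) := by
      rw [Real.sin_add_pi_div_two, Real.sin_two_mul]
      ring
    have h0 : 2 * Real.sin (2 * t) ≠ 0 := mul_ne_zero two_ne_zero ht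
    rw [hk] at h0
    rw [hk, Real.log_mul (left_ne_zero_of_mul h0) (right_ne_zero_of_mul h0)]
  rw [intervalIntegral.integral_congr_ae' (hae.mono fun _ h _ => h) (hae.mono fun _ h _ => h),
    intervalIntegral.integral_add (intervalIntegrable_log_two_sin _ _)] at h
  · rw [integral_log_two_sin] at h2
    simp only [smul_eq_mul, h2, mul_zero, zero_add, logTwoSinIntegral_pi_div_two, sub_zero] at h
    simp only [integral_log_two_sin, logTwoSinIntegral_zero] at h
    linarith
  · simpa using (intervalIntegrable_log_two_sin (0 + Real.pi / 2) (x + Real.pi / 2)).comp_add_right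
      (Real.pi / 2)

/-- Integrated form of 2 sin 3t = ∏ 2 sin(t + kπ/3), k = 0, 1, 2; the constants L(π/3) and L(2π/3)
cancel by reflection. -/
theorem logTwoSinIntegral_three_mul (x : ℝ) :
    logTwoSinIntegral (3 * x) =
      3 * (logTwoSinIntegral x + logTwoSinIntegral (x + Real.pi / 3) +
        logTwoSinIntegral (x + 2 * Real.pi / 3)) := by
  have h := intervalIntegral.integral_comp_mul_left (a := 0) (b := x)
    (fun t => Real.log (2 * Real.sin t)) (three_ne_zero (α := ℝ))
  have h2 := intervalIntegral.integral_comp_add_right (a := 0) (b := x)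
    (fun t => Real.log (2 * Real.sin t)) (Real.pi / 3)
  have h3 := intervalIntegral.integral_comp_add_right (a := 0) (b := x)
    (fun t => Real.log (2 * Real.sin t)) (2 * Real.pi / 3)
  have key : ∀ t : ℝ, 2 * Real.sin (3 * t) = 2 * Real.sin t * (2 * Real.sin (t + Real.pi / 3)) *
      (2 * Real.sin (t + 2 * Real.pi / 3)) := by
    intro t
    have e : 2 * Real.pi / 3 = Real.pi - Real.pi / 3 := by ring
    have hs : Real.sqrt 3 * Real.sqrt 3 = 3 := Real.mul_self_sqrt (by norm_num)
    rw [e, Real.sin_add, Real.sin_add, Real.sin_pi_sub, Real.cos_pi_sub, Real.sin_pi_div_three,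
      Real.cos_pi_div_three, Real.sin_three_mul]
    have hc := Real.sin_sq_add_cos_sq t
    linear_combination (-2 * Real.sin t * Real.cos t ^ 2) * hs - 6 * Real.sin t * hc
  have hae : ∀ᵐ t : ℝ, Real.log (2 * Real.sin (3 * t)) =
      Real.log (2 * Real.sin t) + Real.log (2 * Real.sin (t + Real.pi / 3)) +
        Real.log (2 * Real.sin (t + 2 * Real.pi / 3)) := by
    filter_upwards [ae_sin_mul_ne_zero three_ne_zero] with t ht
    have hk := key t
    have h0 : 2 * Real.sin (3 * t) ≠ 0 := mul_ne_zero two_ne_zero ht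
    rw [hk] at h0
    rw [hk, Real.log_mul (left_ne_zero_of_mul h0) (right_ne_zero_of_mul h0),
      Real.log_mul (left_ne_zero_of_mul (left_ne_zero_of_mul h0))
        (right_ne_zero_of_mul (left_ne_zero_of_mul h0))]
  have hi : ∀ c : ℝ,
      IntervalIntegrable (fun t => Real.log (2 * Real.sin (t + c))) volume 0 x := fun c => by
    simpa using (intervalIntegrable_log_two_sin (0 + c) (x + c)).comp_add_right c
  rw [intervalIntegral.integral_congr_ae' (hae.mono fun _ h _ => h) (hae.mono fun _ h _ => h),
    intervalIntegral.integral_add ((intervalIntegrable_log_two_sin _ _).add (hi _)) (hi _),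
    intervalIntegral.integral_add (intervalIntegrable_log_two_sin _ _) (hi _), h2, h3] at h
  simp only [smul_eq_mul, integral_log_two_sin, logTwoSinIntegral_zero, mul_zero, zero_add] at h
  have hp := logTwoSinIntegral_pi_sub (Real.pi / 3)
  rw [show Real.pi - Real.pi / 3 = 2 * Real.pi / 3 by ring] at hp
  linarith

theorem three_mul_logTwoSinIntegral_pi_div_three :
    3 * logTwoSinIntegral (Real.pi / 3) = 2 * logTwoSinIntegral (Real.pi / 6) := by
  have h := logTwoSinIntegral_two_mul (Real.pi / 6)
  have hp := logTwoSinIntegral_pi_sub (Real.pi / 3)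
  rw [show Real.pi - Real.pi / 3 = Real.pi / 6 + Real.pi / 2 by ring] at hp
  rw [show 2 * (Real.pi / 6) = Real.pi / 3 by ring] at h
  linarith

/-- Triplication at π/12, where the third angle 3π/4 reflects to π/4. -/
theorem three_mul_logTwoSinIntegral_pi_div_twelve_add :
    3 * (logTwoSinIntegral (Real.pi / 12) + logTwoSinIntegral (5 * Real.pi / 12)) =
      4 * logTwoSinIntegral (Real.pi / 4) := by
  have h := logTwoSinIntegral_three_mul (Real.pi / 12)
  have hp := logTwoSinIntegral_pi_sub (Real.pi / 4)
  rw [show Real.pi - Real.pi / 4 = Real.pi / 12 + 2 * Real.pi / 3 by ring] at hp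
  rw [show 3 * (Real.pi / 12) = Real.pi / 4 by ring,
    show Real.pi / 12 + Real.pi / 3 = 5 * Real.pi / 12 by ring] at h
  linarith

/-! ### The Bloch–Wigner dilogarithm on the unit circle. -/

theorem one_sub_mul_exp_mem_slitPlane {t φ : ℝ} (ht0 : 0 ≤ t) (hφ : φ ∈ Set.Ioo 0 (2 * Real.pi)) :
    1 - t * Complex.exp (φ * Complex.I) ∈ Complex.slitPlane := by
  rw [Complex.mem_slitPlane_iff]
  have him : (1 - t * Complex.exp (φ * Complex.I)).im = -(t * Real.sin φ) := by
    simp [Complex.exp_ofReal_mul_I_im]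
  have hre : (1 - t * Complex.exp (φ * Complex.I)).re = 1 - t * Real.cos φ := by
    simp [Complex.exp_ofReal_mul_I_re]
  rw [him, hre]
  by_cases hs : t * Real.sin φ = 0
  · left
    rcases mul_eq_zero.1 hs with h | h
    · simp [h]
    · obtain ⟨n, hn⟩ := Real.sin_eq_zero_iff.1 h
      -- The only real point of the arc is φ = π, where the real part is 1 + t > 0.
      have hn1 : n = 1 := by
        have h1 : (0 : ℝ) < n := by
          by_contra! hc
          nlinarith [hφ.1, Real.pi_pos]
        have h2 : (n : ℝ) < 2 := by
          by_contra! hc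
          nlinarith [hφ.2, Real.pi_pos]
        have h1' : 0 < n := by exact_mod_cast h1
        have h2' : n < 2 := by exact_mod_cast h2
        omega
      rw [hn1] at hn
      rw [← hn]
      simp
      linarith
  · right
    simpa using hs

/-- The singularity at t = 0 is removable: the integrand agrees for t ≠ 0 with the slope from 0 of
the differentiable function log(1 - t e^{iφ}), which is continuous on [0, 1]. -/
theorem intervalIntegrable_log_one_sub_mul_div {φ : ℝ} (hφ : φ ∈ Set.Ioo 0 (2 * Real.pi)) :
    IntervalIntegrable
      (fun t : ℝ => Complex.log (1 - t * Complex.exp (φ * Complex.I)) / t) volume 0 1 := by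
  set f : ℝ → ℂ := fun t => Complex.log (1 - t * Complex.exp (φ * Complex.I)) with hf
  set s : Set ℝ := {t | 1 - t * Complex.exp (φ * Complex.I) ∈ Complex.slitPlane} with hs
  have hso : IsOpen s := Complex.isOpen_slitPlane.preimage (by fun_prop)
  have hs0 : ∀ t : ℝ, 0 ≤ t → t ∈ s := fun t ht => one_sub_mul_exp_mem_slitPlane ht hφ
  have hd : DifferentiableAt ℝ f 0 := by
    have h1 : HasDerivAt (fun t : ℝ => 1 - (t : ℂ) * Complex.exp (φ * Complex.I))
        (-(1 * Complex.exp (φ * Complex.I))) 0 :=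
      ((Complex.ofRealCLM.hasDerivAt (x := 0)).mul_const _).const_sub 1
    exact (h1.clog_real (hs0 0 le_rfl)).differentiableAt
  have hf : ContinuousOn f s := ContinuousOn.clog (by fun_prop) fun t ht => ht
  have hc : ContinuousOn (dslope f 0) s :=
    (continuousOn_dslope (hso.mem_nhds (hs0 0 le_rfl))).2 ⟨hf, hd⟩
  have hi : IntervalIntegrable (dslope f 0) volume 0 1 :=
    (hc.mono fun t ht => hs0 t (by rw [Set.uIcc_of_le zero_le_one] at ht; exact ht.1)).intervalIntegrable
  refine hi.congr fun t ht => ?_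
  rw [Set.uIoc_of_le zero_le_one] at ht
  rw [dslope_of_ne _ ht.1.ne', slope_def_module]
  simp [f, div_eq_inv_mul]

theorem integral_exp_div_one_sub_mul_exp {φ : ℝ} (hφ : φ ∈ Set.Ioo 0 (2 * Real.pi)) :
    ∫ t in (0 : ℝ)..1, -Complex.exp (φ * Complex.I) / (1 - t * Complex.exp (φ * Complex.I)) =
      Complex.log (1 - Complex.exp (φ * Complex.I)) := by
  have h := intervalIntegral.integral_eq_sub_of_hasDerivAt (a := 0) (b := 1)
    (f := fun t : ℝ => Complex.log (1 - t * Complex.exp (φ * Complex.I)))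
    (f' := fun t : ℝ => -Complex.exp (φ * Complex.I) / (1 - t * Complex.exp (φ * Complex.I)))
    (fun t ht => by
      rw [Set.uIcc_of_le zero_le_one] at ht
      have h1 : HasDerivAt (fun t : ℝ => 1 - (t : ℂ) * Complex.exp (φ * Complex.I))
          (-(1 * Complex.exp (φ * Complex.I))) t :=
        ((Complex.ofRealCLM.hasDerivAt (x := t)).mul_const _).const_sub 1
      simpa using h1.clog_real (one_sub_mul_exp_mem_slitPlane ht.1 hφ))
    (ContinuousOn.intervalIntegrable (by
      refine ContinuousOn.div (by fun_prop) (by fun_prop) fun t ht => ?_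
      rw [Set.uIcc_of_le zero_le_one] at ht
      exact Complex.slitPlane_ne_zero (one_sub_mul_exp_mem_slitPlane ht.1 hφ)))
  simpa using h

/-- Differentiation under the integral sign cancels the factor 1/t and leaves an elementary
integral. -/
theorem hasDerivAt_dilog_exp {φ : ℝ} (hφ : φ ∈ Set.Ioo 0 (2 * Real.pi)) :
    HasDerivAt (fun x : ℝ => dilog (Complex.exp (x * Complex.I)))
      (-Complex.I * Complex.log (1 - Complex.exp (φ * Complex.I))) φ := by
  obtain ⟨ε, hε, hball⟩ := Metric.nhds_basis_closedBall.mem_iff.1 (isOpen_Ioo.mem_nhds hφ)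
  set F' : ℝ → ℝ → ℂ := fun x t =>
    Complex.I * (-Complex.exp (x * Complex.I) / (1 - t * Complex.exp (x * Complex.I))) with hF'
  have hcont : ContinuousOn (fun p : ℝ × ℝ => F' p.1 p.2)
      (Metric.closedBall φ ε ×ˢ Set.Icc 0 1) := by
    refine ContinuousOn.mul continuousOn_const (ContinuousOn.div (by fun_prop) (by fun_prop) ?_)
    rintro ⟨x, t⟩ ⟨hx, ht⟩
    exact Complex.slitPlane_ne_zero (one_sub_mul_exp_mem_slitPlane ht.1 (hball hx))
  obtain ⟨C, hC⟩ := ((isCompact_closedBall φ ε).prod isCompact_Icc).exists_bound_of_continuousOn hcont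
  have h := (intervalIntegral.hasDerivAt_integral_of_dominated_loc_of_deriv_le
    (μ := volume) (a := 0) (b := 1) (x₀ := φ) (s := Metric.closedBall φ ε)
    (F := fun x t : ℝ => Complex.log (1 - t * Complex.exp (x * Complex.I)) / t)
    (F' := F') (bound := fun _ => C) (Metric.closedBall_mem_nhds φ hε)
    (Filter.Eventually.of_forall fun x =>
      (Measurable.aestronglyMeasurable (by fun_prop)))
    (intervalIntegrable_log_one_sub_mul_div hφ)
    (Measurable.aestronglyMeasurable (by fun_prop))
    (Filter.Eventually.of_forall fun t ht x hx => by
      rw [Set.uIoc_of_le zero_le_one] at ht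
      exact hC (x, t) ⟨hx, ht.1.le, ht.2⟩)
    intervalIntegrable_const
    (Filter.Eventually.of_forall fun t ht x hx => by
      rw [Set.uIoc_of_le zero_le_one] at ht
      have h1 : HasDerivAt (fun x : ℝ => Complex.exp (x * Complex.I))
          (Complex.exp (x * Complex.I) * (1 * Complex.I)) x :=
        ((Complex.ofRealCLM.hasDerivAt (x := x)).mul_const _).cexp
      have h2 := (((h1.const_mul (t : ℂ)).const_sub 1).clog_real
        (one_sub_mul_exp_mem_slitPlane ht.1.le (hball hx))).div_const (t : ℂ)
      have ht0 : (t : ℂ) ≠ 0 := by exact_mod_cast ht.1.ne'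
      have hne := Complex.slitPlane_ne_zero (one_sub_mul_exp_mem_slitPlane ht.1.le (hball hx))
      refine h2.congr_deriv ?_
      simp only [hF']
      field_simp)).2
  have h' := h.neg
  simp only [hF', intervalIntegral.integral_const_mul, integral_exp_div_one_sub_mul_exp hφ] at h'
  rw [← neg_mul] at h'
  exact h'

theorem log_norm_one_sub_exp (φ : ℝ) :
    Real.log ‖1 - Complex.exp (φ * Complex.I)‖ = Real.log (2 * Real.sin (φ / 2)) := by
  rw [mul_comm, ← norm_neg, neg_sub, Complex.norm_exp_I_mul_ofReal_sub_one, Real.norm_eq_abs,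
    Real.log_abs]

theorem dilog_neg_one_im : (dilog (-1)).im = 0 := by
  have h : ∫ t in (0 : ℝ)..1, Complex.log (1 - t * (-1)) / t =
      ∫ t in (0 : ℝ)..1, ((Real.log (1 + t) / t : ℝ) : ℂ) := by
    refine intervalIntegral.integral_congr fun t ht => ?_
    rw [Set.uIcc_of_le zero_le_one] at ht
    have : (1 : ℂ) - t * (-1) = ((1 + t : ℝ) : ℂ) := by push_cast; ring
    simp only [this]
    rw [← Complex.ofReal_log (by linarith [ht.1]), Complex.ofReal_div]
  rw [dilog, h, intervalIntegral.integral_ofReal, Complex.neg_im, Complex.ofReal_im, neg_zero]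

/-- Both sides have derivative -log |1 - e^{iθ}| = -log(2 sin(θ/2)). -/
theorem dilog_exp_im {θ : ℝ} (hθ : θ ∈ Set.Ioo 0 (2 * Real.pi)) :
    (dilog (Complex.exp (θ * Complex.I))).im = -2 * logTwoSinIntegral (θ / 2) := by
  set g : ℝ → ℝ := fun x =>
    (dilog (Complex.exp (x * Complex.I))).im + 2 * logTwoSinIntegral (x / 2) with hg
  have hd : ∀ x ∈ Set.Ioo 0 (2 * Real.pi), HasDerivAt g 0 x := fun x hx => by
    have h1 := Complex.imCLM.hasFDerivAt.comp_hasDerivAt x (hasDerivAt_dilog_exp hx)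
    have hs : Real.sin (x / 2) ≠ 0 :=
      (Real.sin_pos_of_pos_of_lt_pi (by linarith [hx.1]) (by linarith [hx.2])).ne'
    have h2 := ((hasDerivAt_logTwoSinIntegral hs).comp x ((hasDerivAt_id x).div_const 2)).const_mul 2
    have h3 := h1.add h2
    refine h3.congr_deriv ?_
    simp only [Complex.imCLM_apply, Complex.mul_im, Complex.neg_re, Complex.neg_im, Complex.I_re,
      Complex.I_im, Complex.log_re, log_norm_one_sub_exp x]
    ring
  -- The constant is fixed at θ = π, where Li₂(-1) is real and L(π/2) = 0; the endpoint 0 is outside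
  -- the open arc.
  have hpi : Real.pi ∈ Set.Ioo 0 (2 * Real.pi) := ⟨Real.pi_pos, by linarith [Real.pi_pos]⟩
  have h := isOpen_Ioo.is_const_of_deriv_eq_zero isPreconnected_Ioo
    (fun x hx => (hd x hx).differentiableAt.differentiableWithinAt)
    (fun x hx => (hd x hx).deriv) hθ hpi
  simp only [hg, Complex.exp_pi_mul_I, dilog_neg_one_im, logTwoSinIntegral_pi_div_two] at h
  linarith

theorem blochWigner_exp {θ : ℝ} (hθ : θ ∈ Set.Ioo 0 Real.pi) :
    blochWigner (Complex.exp (θ * Complex.I)) = -2 * logTwoSinIntegral (θ / 2) := by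
  have him : (Complex.exp (θ * Complex.I)).im ≠ 0 := by
    rw [Complex.exp_ofReal_mul_I_im]
    exact (Real.sin_pos_of_mem_Ioo hθ).ne'
  rw [blochWigner, if_neg fun h => him h.1, Complex.norm_exp_ofReal_mul_I, Real.log_one, zero_mul,
    add_zero, dilog_exp_im ⟨hθ.1, by linarith [hθ.1, hθ.2]⟩]

theorem blochWigner_I : blochWigner Complex.I = -2 * logTwoSinIntegral (Real.pi / 4) := by
  have h := blochWigner_exp (θ := Real.pi / 2) ⟨by positivity, by linarith [Real.pi_pos]⟩
  rwa [Complex.ofReal_div, Complex.ofReal_ofNat, Complex.exp_pi_div_two_mul_I,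
    show Real.pi / 2 / 2 = Real.pi / 4 by ring] at h

theorem blochWigner_exp_two_pi_mul_I_div_three :
    blochWigner (Complex.exp (2 * Real.pi * Complex.I / 3)) =
      -2 * logTwoSinIntegral (Real.pi / 3) := by
  have h := blochWigner_exp (θ := 2 * Real.pi / 3) ⟨by positivity, by linarith [Real.pi_pos]⟩
  rw [show 2 * Real.pi / 3 / 2 = Real.pi / 3 by ring] at h
  rw [← h]
  congr 2
  push_cast
  ring

/-! ### The two logarithmic integrals. -/

theorem integral_log_four_mul_cos_sq_sub_one :
    ∫ φ in (0 : ℝ)..(Real.pi / 4), Real.log (4 * Real.cos φ ^ 2 - 1) =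
      -(4 / 3) * logTwoSinIntegral (Real.pi / 4) := by
  have hae : ∀ᵐ t : ℝ, Real.log (4 * Real.cos t ^ 2 - 1) =
      Real.log (2 * Real.sin (3 * t)) - Real.log (2 * Real.sin t) := by
    filter_upwards [ae_sin_mul_ne_zero three_ne_zero] with t ht
    have hk : Real.sin (3 * t) = Real.sin t * (4 * Real.cos t ^ 2 - 1) := by
      rw [Real.sin_three_mul]
      linear_combination (-4 * Real.sin t) * Real.sin_sq_add_cos_sq t
    rw [hk] at ht ⊢
    rw [← mul_assoc, Real.log_mul (mul_ne_zero two_ne_zero (left_ne_zero_of_mul ht))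
      (right_ne_zero_of_mul ht), add_sub_cancel_left]
  have h := intervalIntegral.integral_comp_mul_left (a := 0) (b := Real.pi / 4)
    (fun t => Real.log (2 * Real.sin t)) (three_ne_zero (α := ℝ))
  have hi : IntervalIntegrable (fun t => Real.log (2 * Real.sin (3 * t))) volume 0
      (Real.pi / 4) := by
    simpa using (intervalIntegrable_log_two_sin (3 * 0) (3 * (Real.pi / 4))).comp_mul_left (c := 3)
  rw [intervalIntegral.integral_congr_ae' (hae.mono fun _ h _ => h) (hae.mono fun _ h _ => h),
    intervalIntegral.integral_sub hi (intervalIntegrable_log_two_sin _ _), h]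
  have hp := logTwoSinIntegral_pi_sub (Real.pi / 4)
  rw [show Real.pi - Real.pi / 4 = 3 * (Real.pi / 4) by ring] at hp
  simp only [integral_log_two_sin, mul_zero, logTwoSinIntegral_zero, hp, smul_eq_mul]
  ring

theorem sin_pi_div_twelve : Real.sin (Real.pi / 12) = √2 / 2 * ((√3 - 1) / 2) := by
  rw [show Real.pi / 12 = Real.pi / 3 - Real.pi / 4 by ring, Real.sin_sub, Real.sin_pi_div_three,
    Real.cos_pi_div_three, Real.sin_pi_div_four, Real.cos_pi_div_four]
  ring

theorem cos_pi_div_twelve : Real.cos (Real.pi / 12) = √2 / 2 * ((√3 + 1) / 2) := by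
  rw [show Real.pi / 12 = Real.pi / 3 - Real.pi / 4 by ring, Real.cos_sub, Real.sin_pi_div_three,
    Real.cos_pi_div_three, Real.sin_pi_div_four, Real.cos_pi_div_four]
  ring

section
variable {a b r : ℝ}

/-- As functions of r, the sines vanish where the linear factors do: with 2ab = 1, r = 1/a gives
arctan(br) = 5π/12 and r = -1/b gives arctan(br) = -π/4. The powers of √(1 + (br)²) cancel. -/
theorem log_two_sin_arctan_identity_left (ha : a = (√3 - 1) / 2) (hb : b = (√3 + 1) / 2)
    (hb0 : 0 < b) (hr : 0 < r) (har : a * r < 1) :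
    Real.log (2 * Real.sin (5 * Real.pi / 12 - Real.arctan (b * r))) +
      Real.log (2 * Real.sin (Real.pi / 4 + Real.arctan (b * r))) -
      Real.log (2 * Real.sin (2 * Real.arctan (b * r))) =
      Real.log ((1 - a * r) * (1 + b * r) / (2 * r)) := by
  have hB : 0 < √(1 + (b * r) ^ 2) := by positivity
  have hBs : √(1 + (b * r) ^ 2) ^ 2 = 1 + (b * r) ^ 2 := Real.sq_sqrt (by positivity)
  have h2 : √2 ^ 2 = 2 := Real.sq_sqrt (by norm_num)
  have e1 : 2 * Real.sin (5 * Real.pi / 12 - Real.arctan (b * r)) =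
      √2 * b * (1 - a * r) / √(1 + (b * r) ^ 2) := by
    rw [Real.sin_sub, show 5 * Real.pi / 12 = Real.pi / 2 - Real.pi / 12 by ring,
      Real.sin_pi_div_two_sub, Real.cos_pi_div_two_sub, sin_pi_div_twelve, cos_pi_div_twelve,
      Real.sin_arctan, Real.cos_arctan, ← ha, ← hb]
    field_simp
  have e2 : 2 * Real.sin (Real.pi / 4 + Real.arctan (b * r)) =
      √2 * (1 + b * r) / √(1 + (b * r) ^ 2) := by
    rw [Real.sin_add, Real.sin_pi_div_four, Real.cos_pi_div_four, Real.sin_arctan, Real.cos_arctan]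
    field_simp
  have e3 : 2 * Real.sin (2 * Real.arctan (b * r)) = 4 * b * r / √(1 + (b * r) ^ 2) ^ 2 := by
    rw [Real.sin_two_mul, Real.sin_arctan, Real.cos_arctan]
    field_simp
    ring
  have h1 : 0 < 1 - a * r := by linarith
  rw [e1, e2, e3, ← Real.log_mul (by positivity) (by positivity),
    ← Real.log_div (by positivity) (by positivity)]
  congr 1
  field_simp
  rw [h2]
  ring

/-- The same right-hand side in terms of arctan(ar): here r = 1/a gives π/4 and r = -1/b gives
-π/12. -/
theorem log_two_sin_arctan_identity_right (ha : a = (√3 - 1) / 2) (hb : b = (√3 + 1) / 2)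
    (ha0 : 0 < a) (hb0 : 0 < b) (hr : 0 < r) (har : a * r < 1) :
    Real.log (2 * Real.sin (Real.pi / 4 - Real.arctan (a * r))) +
      Real.log (2 * Real.sin (Real.pi / 12 + Real.arctan (a * r))) -
      Real.log (2 * Real.sin (2 * Real.arctan (a * r))) =
      Real.log ((1 - a * r) * (1 + b * r) / (2 * r)) := by
  have hB : 0 < √(1 + (a * r) ^ 2) := by positivity
  have h2 : √2 ^ 2 = 2 := Real.sq_sqrt (by norm_num)
  have e1 : 2 * Real.sin (Real.pi / 12 + Real.arctan (a * r)) =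
      √2 * a * (1 + b * r) / √(1 + (a * r) ^ 2) := by
    rw [Real.sin_add, sin_pi_div_twelve, cos_pi_div_twelve,
      Real.sin_arctan, Real.cos_arctan, ← ha, ← hb]
    field_simp
  have e2 : 2 * Real.sin (Real.pi / 4 - Real.arctan (a * r)) =
      √2 * (1 - a * r) / √(1 + (a * r) ^ 2) := by
    rw [Real.sin_sub, Real.sin_pi_div_four, Real.cos_pi_div_four, Real.sin_arctan, Real.cos_arctan]
    field_simp
  have e3 : 2 * Real.sin (2 * Real.arctan (a * r)) = 4 * a * r / √(1 + (a * r) ^ 2) ^ 2 := by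
    rw [Real.sin_two_mul, Real.sin_arctan, Real.cos_arctan]
    field_simp
    ring
  have h1 : 0 < 1 - a * r := by linarith
  rw [e1, e2, e3, ← Real.log_mul (by positivity) (by positivity),
    ← Real.log_div (by positivity) (by positivity)]
  congr 1
  field_simp
  rw [h2]
  ring

theorem sin_arctan_sub_arctan (hab : b - a = 1) :
    Real.sin (Real.arctan (b * r) - Real.arctan (a * r)) =
      r / (√(1 + (a * r) ^ 2) * √(1 + (b * r) ^ 2)) := by
  have hA : 0 < √(1 + (a * r) ^ 2) := by positivity
  have hB : 0 < √(1 + (b * r) ^ 2) := by positivity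
  rw [Real.sin_sub, Real.sin_arctan, Real.cos_arctan, Real.sin_arctan, Real.cos_arctan]
  field_simp
  rw [hab, mul_one]

/-- For u = arctan(br) - arctan(ar), sin u : cos u = r : 1 + r²/2, so 1 - 3 sin² u = cos² u - 2 sin²
u is proportional to the square (1 + r²/2)² - 2r² = (1 - r²/2)². The same a and b factor the
numerator 1 + r - r²/2. -/
theorem sin_add_sqrt_arctan_sub_arctan (hab : b - a = 1) (hab' : 2 * (a * b) = 1)
    (hr : r ^ 2 ≤ 2) :
    Real.sin (Real.arctan (b * r) - Real.arctan (a * r)) +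
      √(1 - 3 * Real.sin (Real.arctan (b * r) - Real.arctan (a * r)) ^ 2) =
      (1 - a * r) * (1 + b * r) / (√(1 + (a * r) ^ 2) * √(1 + (b * r) ^ 2)) := by
  have hA : 0 < √(1 + (a * r) ^ 2) := by positivity
  have hB : 0 < √(1 + (b * r) ^ 2) := by positivity
  have hAs : √(1 + (a * r) ^ 2) ^ 2 = 1 + (a * r) ^ 2 := Real.sq_sqrt (by positivity)
  have hBs : √(1 + (b * r) ^ 2) ^ 2 = 1 + (b * r) ^ 2 := Real.sq_sqrt (by positivity)
  have hs : √(1 - 3 * Real.sin (Real.arctan (b * r) - Real.arctan (a * r)) ^ 2) =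
      (1 - r ^ 2 / 2) / (√(1 + (a * r) ^ 2) * √(1 + (b * r) ^ 2)) := by
    have h0 : 0 ≤ 1 - r ^ 2 / 2 := by linarith
    rw [sin_arctan_sub_arctan hab, ← Real.sqrt_sq (div_nonneg h0 (mul_pos hA hB).le), div_pow,
      div_pow, mul_pow, hAs, hBs]
    congr 1
    have hA' : 1 + (a * r) ^ 2 ≠ 0 := by positivity
    have hB' : 1 + (b * r) ^ 2 ≠ 0 := by positivity
    field_simp
    linear_combination (4 * r ^ 2 * (b - a + 1)) * hab + (4 * r ^ 2 + r ^ 4 * (2 * a * b + 1)) * hab'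
  rw [hs, sin_arctan_sub_arctan hab, ← add_div]
  congr 1
  linear_combination (-r) * hab + (r ^ 2 / 2) * hab'

end

theorem arctan_two_mul_sq : Real.arctan ((√3 - 1) / 2 * (√3 - 1)) = Real.pi / 12 := by
  refine Real.arctan_eq_of_tan_eq ?_ ⟨by linarith [Real.pi_pos], by linarith [Real.pi_pos]⟩
  have h3 : √3 * √3 = 3 := Real.mul_self_sqrt (by norm_num)
  have h2 : 0 < √2 := by positivity
  have h : 0 < √3 + 1 := by positivity
  rw [Real.tan_eq_sin_div_cos, sin_pi_div_twelve, cos_pi_div_twelve]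
  field_simp
  linear_combination (1 - √3) * h3

theorem integral_log_sin_add_sqrt :
    ∫ u in (0 : ℝ)..(Real.pi / 6), Real.log (Real.sin u + √(1 - 3 * Real.sin u ^ 2)) =
      1 / 2 * logTwoSinIntegral (Real.pi / 6) - 2 / 3 * logTwoSinIntegral (Real.pi / 4) := by
  obtain ⟨a, ha⟩ : ∃ a, a = (√3 - 1) / 2 := ⟨_, rfl⟩
  obtain ⟨b, hb⟩ : ∃ b, b = (√3 + 1) / 2 := ⟨_, rfl⟩
  have h3 : √3 * √3 = 3 := Real.mul_self_sqrt (by norm_num)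
  have hab : b - a = 1 := by rw [ha, hb]; ring
  have hab' : 2 * (a * b) = 1 := by rw [ha, hb]; linear_combination (1 / 2) * h3
  have hb0 : 0 < b := by rw [hb]; positivity
  have ha0 : 0 < a := by
    by_contra! h
    nlinarith
  have ha1 : a < 1 / 2 := by nlinarith
  have har : ∀ r ∈ Set.Icc 0 (2 * a), a * r < 1 := fun r hr => by nlinarith [hr.1, hr.2]
  have hr2 : ∀ r ∈ Set.Icc 0 (2 * a), r ^ 2 ≤ 2 := fun r hr => by nlinarith [hr.1, hr.2]
  set β : ℝ → ℝ := fun r => Real.arctan (b * r) with hβ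
  set α : ℝ → ℝ := fun r => Real.arctan (a * r) with hα
  set β' : ℝ → ℝ := fun r => (1 + (b * r) ^ 2)⁻¹ * b with hβ'
  set α' : ℝ → ℝ := fun r => (1 + (a * r) ^ 2)⁻¹ * a with hα'
  have dβ : ∀ r, HasDerivAt β (β' r) r := fun r => by
    simpa [β, β'] using ((hasDerivAt_id r).const_mul b).arctan
  have dα : ∀ r, HasDerivAt α (α' r) r := fun r => by
    simpa [α, α'] using ((hasDerivAt_id r).const_mul a).arctan
  have cβ' : Continuous β' := by
    refine (Continuous.inv₀ (by fun_prop) fun r => ?_).mul continuous_const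
    positivity
  have cα' : Continuous α' := by
    refine (Continuous.inv₀ (by fun_prop) fun r => ?_).mul continuous_const
    positivity
  set f : ℝ → ℝ := fun u => Real.log (Real.sin u + √(1 - 3 * Real.sin u ^ 2)) with hf
  have hpos : ∀ r ∈ Set.Icc 0 (2 * a),
      0 < Real.sin (β r - α r) + √(1 - 3 * Real.sin (β r - α r) ^ 2) := fun r hr => by
    rw [sin_add_sqrt_arctan_sub_arctan hab hab' (hr2 r hr)]
    have h1 : 0 < 1 - a * r := by linarith [har r hr]
    have := hr.1
    positivity
  have h2a : (0 : ℝ) ≤ 2 * a := by linarith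
  -- Substitution u = β - α; at r = 2a one has br = 1 and ar = 2 - √3, so u = π/4 - π/12 = π/6.
  have hsub := intervalIntegral.integral_comp_mul_deriv' (a := 0) (b := 2 * a)
    (f := fun r => β r - α r) (f' := fun r => β' r - α' r) (g := f)
    (fun r _ => (dβ r).sub (dα r)) (cβ'.sub cα').continuousOn (by
      rintro _ ⟨r, hr, rfl⟩
      rw [Set.uIcc_of_le h2a] at hr
      have : ContinuousAt f (β r - α r) :=
        (by fun_prop : ContinuousAt (fun u => Real.sin u + √(1 - 3 * Real.sin u ^ 2)) _).log
          (hpos r hr).ne'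
      exact this.continuousWithinAt)
  have eβ : β (2 * a) = Real.pi / 4 := by
    simp only [hβ]
    rw [show b * (2 * a) = 1 by linarith, Real.arctan_one]
  have eα : α (2 * a) = Real.pi / 12 := by
    simp only [hα]
    rw [← arctan_two_mul_sq, ha]
    ring_nf
  have e0 : β 0 = 0 ∧ α 0 = 0 := by simp [hβ, hα]
  simp only [eβ, eα, e0.1, e0.2, sub_zero] at hsub
  rw [show Real.pi / 4 - Real.pi / 12 = Real.pi / 6 by ring] at hsub
  rw [← hsub]
  -- The primitive. In du = β' dr - α' dr, the factor log((1 - ar)(1 + br)/(2r)) is rewritten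
  -- through β alone in the first term and through α alone in the second.
  set F : ℝ → ℝ := fun r => logTwoSinIntegral (β r - α r) -
    logTwoSinIntegral (5 * Real.pi / 12 - β r) + logTwoSinIntegral (Real.pi / 4 + β r) -
    1 / 2 * logTwoSinIntegral (2 * β r) + logTwoSinIntegral (Real.pi / 4 - α r) -
    logTwoSinIntegral (Real.pi / 12 + α r) + 1 / 2 * logTwoSinIntegral (2 * α r) with hF
  have cβ : Continuous β := continuous_iff_continuousAt.2 fun r => (dβ r).continuousAt
  have cα : Continuous α := continuous_iff_continuousAt.2 fun r => (dα r).continuousAt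
  have cF : Continuous F := by
    have := continuous_logTwoSinIntegral
    fun_prop
  have key : ∫ r in (0 : ℝ)..(2 * a), (f ∘ fun r => β r - α r) r * (β' r - α' r) =
      F (2 * a) - F 0 := by
    -- Differentiability is needed only inside: single terms of F' blow up at r = 0, while F and the
    -- integrand stay continuous.
    refine intervalIntegral.integral_eq_sub_of_hasDerivAt_of_le h2a cF.continuousOn ?_ ?_
    · intro r hr
      have hr' := Set.Ioo_subset_Icc_self hr
      have hbr : 0 < β r := Real.arctan_pos.2 (mul_pos hb0 hr.1)
      have harr : 0 < α r := Real.arctan_pos.2 (mul_pos ha0 hr.1)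
      have hbr1 : β r < Real.pi / 4 := by
        rw [← eβ]
        exact Real.arctan_strictMono (by nlinarith [hr.2])
      have har1 : α r < Real.pi / 12 := by
        rw [← eα]
        exact Real.arctan_strictMono (by nlinarith [hr.2])
      have hu : 0 < β r - α r := by
        rw [sub_pos]
        exact Real.arctan_strictMono (by nlinarith [hr.1])
      have D : ∀ {g : ℝ → ℝ} {g' : ℝ}, HasDerivAt g g' r → 0 < g r → g r < Real.pi →
          HasDerivAt (fun r => logTwoSinIntegral (g r)) (Real.log (2 * Real.sin (g r)) * g') r :=
        fun hg h0 h1 =>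
          (hasDerivAt_logTwoSinIntegral (Real.sin_pos_of_pos_of_lt_pi h0 h1).ne').comp r hg
      have hpi := Real.pi_pos
      have d1 := D ((dβ r).sub (dα r)) hu (by simp only [Pi.sub_apply]; linarith)
      have d2 := D ((dβ r).const_sub (5 * Real.pi / 12)) (by linarith) (by linarith)
      have d3 := D ((dβ r).const_add (Real.pi / 4)) (by linarith) (by linarith)
      have d4 := (D ((dβ r).const_mul 2) (by linarith) (by linarith)).const_mul (1 / 2)
      have d5 := D ((dα r).const_sub (Real.pi / 4)) (by linarith) (by linarith)
      have d6 := D ((dα r).const_add (Real.pi / 12)) (by linarith) (by linarith)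
      have d7 := (D ((dα r).const_mul 2) (by linarith) (by linarith)).const_mul (1 / 2)
      have d := (((((d1.sub d2).add d3).sub d4).add d5).sub d6).add d7
      refine d.congr_deriv ?_
      have i1 := log_two_sin_arctan_identity_left ha hb hb0 hr.1 (har r hr')
      have i2 := log_two_sin_arctan_identity_right ha hb ha0 hb0 hr.1 (har r hr')
      have i3 : f (β r - α r) = Real.log (2 * Real.sin (β r - α r)) +
          Real.log ((1 - a * r) * (1 + b * r) / (2 * r)) := by
        have h1 : 0 < 1 - a * r := by linarith [har r hr']
        have h0 := hr.1
        rw [hf, ← Real.log_mul (by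
            have := Real.sin_pos_of_pos_of_lt_pi hu (by linarith)
            positivity) (by positivity)]
        simp only []
        rw [sin_add_sqrt_arctan_sub_arctan hab hab' (hr2 r hr'), sin_arctan_sub_arctan hab]
        congr 1
        field_simp
      simp only [Function.comp_apply, Pi.sub_apply]
      rw [i3]
      linear_combination β' r * i1 - α' r * i2
    · refine ContinuousOn.intervalIntegrable ?_
      rw [Set.uIcc_of_le h2a]
      refine ContinuousOn.mul ?_ (cβ'.sub cα').continuousOn
      have hc : Continuous fun r => Real.sin (β r - α r) + √(1 - 3 * Real.sin (β r - α r) ^ 2) := by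
        fun_prop
      exact hc.continuousOn.log fun r hr => (hpos r hr).ne'
  rw [key]
  simp only [hF, eβ, eα, e0.1, e0.2]
  rw [show Real.pi / 4 - Real.pi / 12 = Real.pi / 6 by ring,
    show 5 * Real.pi / 12 - Real.pi / 4 = Real.pi / 6 by ring,
    show Real.pi / 4 + Real.pi / 4 = Real.pi / 2 by ring,
    show 2 * (Real.pi / 4) = Real.pi / 2 by ring,
    show Real.pi / 12 + Real.pi / 12 = Real.pi / 6 by ring,
    show 2 * (Real.pi / 12) = Real.pi / 6 by ring]
  simp only [logTwoSinIntegral_pi_div_two, sub_zero, add_zero, mul_zero, logTwoSinIntegral_zero]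
  linarith [three_mul_logTwoSinIntegral_pi_div_twelve_add]

/-! ### The fibre integrals. -/

/-- The polynomial `y² + y (x + 1) + x² + x + 1` at `x = e^{iθ}`, `y = e^{iψ}`. -/
noncomputable def conicOnTorus (θ ψ : ℝ) : ℂ :=
  Complex.exp (ψ * Complex.I) ^ 2 + Complex.exp (ψ * Complex.I) * (Complex.exp (θ * Complex.I) + 1)
    + Complex.exp (θ * Complex.I) ^ 2 + Complex.exp (θ * Complex.I) + 1

/-- The integral of `log |P(e^{iθ}, e^{iψ})|` over `ψ ∈ [0, 2π]`. -/
noncomputable def conicFiberIntegral (θ : ℝ) : ℝ :=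
  ∫ ψ in (0 : ℝ)..(2 * Real.pi), Real.log ‖conicOnTorus θ ψ‖

/-- Jensen's formula, in the form of multiplicativity of the one-variable Mahler measure. -/
theorem conicFiberIntegral_eq {θ : ℝ} {y₁ y₂ : ℂ}
    (h : ∀ y : ℂ, y ^ 2 + y * (Complex.exp (θ * Complex.I) + 1) + Complex.exp (θ * Complex.I) ^ 2 +
      Complex.exp (θ * Complex.I) + 1 = (y - y₁) * (y - y₂)) :
    conicFiberIntegral θ = 2 * Real.pi * (Real.posLog ‖y₁‖ + Real.posLog ‖y₂‖) := by
  have hm := Polynomial.logMahlerMeasure_mul_eq_add_logMahlerMeasure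
    (mul_ne_zero (Polynomial.X_sub_C_ne_zero y₁) (Polynomial.X_sub_C_ne_zero y₂))
  rw [Polynomial.logMahlerMeasure_X_sub_C, Polynomial.logMahlerMeasure_X_sub_C,
    Polynomial.logMahlerMeasure_def, Real.circleAverage_def] at hm
  rw [← hm, conicFiberIntegral, smul_eq_mul, mul_inv_cancel_left₀ Real.two_pi_pos.ne']
  refine intervalIntegral.integral_congr fun ψ _ => ?_
  simp [conicOnTorus, h, circleMap]

theorem exists_conic_roots (θ : ℝ) : ∃ y₁ y₂ : ℂ, ∀ y : ℂ,
    y ^ 2 + y * (Complex.exp (θ * Complex.I) + 1) + Complex.exp (θ * Complex.I) ^ 2 +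
      Complex.exp (θ * Complex.I) + 1 = (y - y₁) * (y - y₂) := by
  set x := Complex.exp (θ * Complex.I)
  obtain ⟨d, hd⟩ := IsAlgClosed.exists_pow_nat_eq ((x + 1) ^ 2 - 4 * (x ^ 2 + x + 1)) zero_lt_two
  refine ⟨(-(x + 1) + d) / 2, (-(x + 1) - d) / 2, fun y => ?_⟩
  linear_combination (1 / 4) * hd

theorem conicFiberIntegral_nonneg (θ : ℝ) : 0 ≤ conicFiberIntegral θ := by
  obtain ⟨y₁, y₂, h⟩ := exists_conic_roots θ
  rw [conicFiberIntegral_eq h]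
  have := Real.pi_pos
  have h1 := Real.posLog_nonneg (x := ‖y₁‖)
  have h2 := Real.posLog_nonneg (x := ‖y₂‖)
  positivity

/-- P has real coefficients, so conjugating x conjugates the roots. -/
theorem conicFiberIntegral_two_pi_sub (θ : ℝ) :
    conicFiberIntegral (2 * Real.pi - θ) = conicFiberIntegral θ := by
  obtain ⟨y₁, y₂, h⟩ := exists_conic_roots θ
  have hx : Complex.exp ((2 * Real.pi - θ : ℝ) * Complex.I) =
      (starRingEnd ℂ) (Complex.exp (θ * Complex.I)) := by
    rw [← Complex.exp_conj, map_mul, Complex.conj_I, Complex.conj_ofReal]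
    push_cast [-Complex.ofReal_cos]
    rw [sub_mul, Complex.exp_sub, Complex.exp_two_pi_mul_I, mul_neg, Complex.exp_neg, one_div]
  rw [conicFiberIntegral_eq h, conicFiberIntegral_eq (y₁ := (starRingEnd ℂ) y₁)
    (y₂ := (starRingEnd ℂ) y₂), Complex.norm_conj, Complex.norm_conj]
  intro y
  have := congrArg (starRingEnd ℂ) (h ((starRingEnd ℂ) y))
  rw [hx]
  simpa using this

/-- With e = e^{iφ}, P(e², eY) = e² (Y² + 2 cos φ · Y + 4 cos² φ - 1), and the rotation by e
preserves moduli. -/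
theorem conicFiberIntegral_two_mul {φ : ℝ} {Y₁ Y₂ : ℂ} (hs : Y₁ + Y₂ = -(2 * Real.cos φ : ℝ))
    (hp : Y₁ * Y₂ = (4 * Real.cos φ ^ 2 - 1 : ℝ)) :
    conicFiberIntegral (2 * φ) = 2 * Real.pi * (Real.posLog ‖Y₁‖ + Real.posLog ‖Y₂‖) := by
  set e := Complex.exp (φ * Complex.I) with he
  have hx : Complex.exp ((2 * φ : ℝ) * Complex.I) = e ^ 2 := by
    rw [he, ← Complex.exp_nat_mul]
    congr 1
    push_cast [-Complex.ofReal_cos]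
    ring
  have hc : 2 * (Real.cos φ : ℂ) * e = e ^ 2 + 1 := by
    rw [Complex.ofReal_cos, Complex.two_cos, ← he, neg_mul, Complex.exp_neg, ← he, add_mul,
      inv_mul_cancel₀ (Complex.exp_ne_zero _), sq]
  have hn : ‖e‖ = 1 := Complex.norm_exp_ofReal_mul_I φ
  rw [conicFiberIntegral_eq (y₁ := e * Y₁) (y₂ := e * Y₂), norm_mul, norm_mul, hn, one_mul, one_mul]
  intro y
  rw [hx]
  push_cast [-Complex.ofReal_cos] at hs hp
  linear_combination y * e * hs - e ^ 2 * hp - (y + e ^ 2 + 1 + 2 * Real.cos φ * e) * hc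

theorem conicFiberIntegral_two_mul_of_nonreal {φ : ℝ} (h : 1 ≤ 3 * Real.cos φ ^ 2) :
    conicFiberIntegral (2 * φ) =
      2 * Real.pi * (2 * Real.posLog √(4 * Real.cos φ ^ 2 - 1)) := by
  have hw : (√(3 * Real.cos φ ^ 2 - 1) : ℂ) ^ 2 = 3 * (Real.cos φ : ℂ) ^ 2 - 1 := by
    rw [← Complex.ofReal_pow, Real.sq_sqrt (by linarith)]
    push_cast [-Complex.ofReal_cos]
    ring
  have hw' := Real.sq_sqrt (sub_nonneg.2 h)
  set w := √(3 * Real.cos φ ^ 2 - 1)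
  rw [conicFiberIntegral_two_mul (Y₁ := -Real.cos φ + w * Complex.I)
    (Y₂ := (-Real.cos φ : ℝ) + (-w : ℝ) * Complex.I)]
  · rw [← Complex.ofReal_neg, Complex.norm_add_mul_I, Complex.norm_add_mul_I, neg_sq, neg_sq, hw',
      two_mul (Real.posLog _)]
    ring_nf
  · push_cast [-Complex.ofReal_cos]
    ring
  · push_cast [-Complex.ofReal_cos]
    linear_combination hw - (w : ℂ) ^ 2 * Complex.I_sq

theorem conicFiberIntegral_two_mul_of_real {φ : ℝ} (h : 3 * Real.cos φ ^ 2 ≤ 1) :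
    conicFiberIntegral (2 * φ) =
      2 * Real.pi * (Real.posLog (Real.cos φ + √(1 - 3 * Real.cos φ ^ 2)) +
        Real.posLog (√(1 - 3 * Real.cos φ ^ 2) - Real.cos φ)) := by
  have hw : (√(1 - 3 * Real.cos φ ^ 2) : ℂ) ^ 2 = 1 - 3 * (Real.cos φ : ℂ) ^ 2 := by
    rw [← Complex.ofReal_pow, Real.sq_sqrt (by linarith)]
    push_cast [-Complex.ofReal_cos]
    ring
  set w := √(1 - 3 * Real.cos φ ^ 2)
  rw [conicFiberIntegral_two_mul (Y₁ := ((-(Real.cos φ + w) : ℝ) : ℂ))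
    (Y₂ := ((w - Real.cos φ : ℝ) : ℂ))]
  · rw [Complex.norm_real, Complex.norm_real, norm_neg, Real.norm_eq_abs, Real.norm_eq_abs,
      Real.posLog_abs, Real.posLog_abs]
  · push_cast [-Complex.ofReal_cos]
    ring
  · push_cast [-Complex.ofReal_cos]
    linear_combination -hw

theorem conicFiberIntegral_two_mul_of_le_pi_div_four {φ : ℝ}
    (hφ : φ ∈ Set.Icc 0 (Real.pi / 4)) :
    conicFiberIntegral (2 * φ) = 2 * Real.pi * Real.log (4 * Real.cos φ ^ 2 - 1) := by
  have hc : √2 / 2 ≤ Real.cos φ := by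
    rw [← Real.cos_pi_div_four]
    exact Real.cos_le_cos_of_nonneg_of_le_pi hφ.1 (by linarith [Real.pi_pos]) hφ.2
  have h2 : √2 ^ 2 = 2 := Real.sq_sqrt (by norm_num)
  have hc2 : 1 / 2 ≤ Real.cos φ ^ 2 := by nlinarith [Real.sqrt_nonneg 2]
  rw [conicFiberIntegral_two_mul_of_nonreal (by linarith), Real.posLog_eq_log,
    Real.log_sqrt (by linarith)]
  · ring
  · rw [abs_of_nonneg (Real.sqrt_nonneg _), Real.one_le_sqrt]
    linarith

theorem conicFiberIntegral_two_mul_of_mem_Icc {φ : ℝ}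
    (hφ : φ ∈ Set.Icc (Real.pi / 4) (Real.pi / 3)) : conicFiberIntegral (2 * φ) = 0 := by
  have hpi := Real.pi_pos
  have hc : Real.cos φ ≤ √2 / 2 := by
    rw [← Real.cos_pi_div_four]
    exact Real.cos_le_cos_of_nonneg_of_le_pi (by positivity) (by linarith [hφ.2]) hφ.1
  have hc' : 1 / 2 ≤ Real.cos φ := by
    rw [← Real.cos_pi_div_three]
    exact Real.cos_le_cos_of_nonneg_of_le_pi (by linarith [hφ.1]) (by linarith) hφ.2
  have h2 : √2 ^ 2 = 2 := Real.sq_sqrt (by norm_num)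
  have hc2 : Real.cos φ ^ 2 ≤ 1 / 2 := by nlinarith [Real.sqrt_nonneg 2]
  rcases le_total 1 (3 * Real.cos φ ^ 2) with h | h
  · rw [conicFiberIntegral_two_mul_of_nonreal h, (Real.posLog_eq_zero_iff _).2]
    · ring
    · rw [abs_of_nonneg (Real.sqrt_nonneg _), Real.sqrt_le_one]
      linarith
  -- Squared, this is cos φ ≤ 2 cos² φ, which is where the threshold cos φ = 1/2 arises.
  · have hw : √(1 - 3 * Real.cos φ ^ 2) ≤ 1 - Real.cos φ :=
      Real.sqrt_le_iff.2 ⟨by nlinarith, by nlinarith⟩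
    have hw0 := Real.sqrt_nonneg (1 - 3 * Real.cos φ ^ 2)
    rw [conicFiberIntegral_two_mul_of_real h, (Real.posLog_eq_zero_iff _).2,
      (Real.posLog_eq_zero_iff _).2]
    · ring
    · rw [abs_le]
      constructor <;> nlinarith
    · rw [abs_le]
      constructor <;> nlinarith

theorem conicFiberIntegral_two_mul_of_pi_div_three_le {φ : ℝ}
    (hφ : φ ∈ Set.Icc (Real.pi / 3) (Real.pi / 2)) :
    conicFiberIntegral (2 * φ) =
      2 * Real.pi * Real.log (Real.cos φ + √(1 - 3 * Real.cos φ ^ 2)) := by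
  have hpi := Real.pi_pos
  have hc : Real.cos φ ≤ 1 / 2 := by
    rw [← Real.cos_pi_div_three]
    exact Real.cos_le_cos_of_nonneg_of_le_pi (by positivity) (by linarith [hφ.2]) hφ.1
  have hc' : 0 ≤ Real.cos φ :=
    Real.cos_nonneg_of_neg_pi_div_two_le_of_le (by linarith [hφ.1]) hφ.2
  have hw : 1 - Real.cos φ ≤ √(1 - 3 * Real.cos φ ^ 2) := Real.le_sqrt_of_sq_le (by nlinarith)
  have hw1 : √(1 - 3 * Real.cos φ ^ 2) ≤ 1 := Real.sqrt_le_one.2 (by nlinarith)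
  rw [conicFiberIntegral_two_mul_of_real (by nlinarith), Real.posLog_eq_log,
    (Real.posLog_eq_zero_iff (√(1 - 3 * Real.cos φ ^ 2) - Real.cos φ)).2, add_zero]
  · rw [abs_le]
    constructor <;> linarith
  · rw [le_abs]
    left
    linarith

/-! ### Absolute convergence on the torus. -/

theorem measurable_log_norm_conicOnTorus :
    Measurable fun p : ℝ × ℝ => Real.log ‖conicOnTorus p.1 p.2‖ := by
  unfold conicOnTorus
  fun_prop

theorem integrableOn_log_norm_conicOnTorus (θ : ℝ) :
    IntegrableOn (fun ψ => Real.log ‖conicOnTorus θ ψ‖) (Set.Icc 0 (2 * Real.pi)) := by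
  have h : MeromorphicOn (fun ψ : ℝ => conicOnTorus θ ψ) (Set.uIcc 0 (2 * Real.pi)) :=
    fun ψ _ => by
      have h1 : AnalyticAt ℝ (fun ψ : ℝ => Complex.exp (ψ * Complex.I)) ψ :=
        (analyticAt_cexp.restrictScalars (𝕜 := ℝ)).comp
          ((Complex.ofRealCLM.analyticAt ψ).mul analyticAt_const)
      unfold conicOnTorus
      exact (((((h1.pow 2).add (h1.mul analyticAt_const)).add analyticAt_const).add
        analyticAt_const).add analyticAt_const).meromorphicAt
  rw [integrableOn_Icc_iff_integrableOn_Ioc]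
  exact (intervalIntegrable_iff_integrableOn_Ioc_of_le Real.two_pi_pos.le).1
    h.intervalIntegrable_log_norm

theorem norm_conicOnTorus_le (θ ψ : ℝ) : ‖conicOnTorus θ ψ‖ ≤ 6 := by
  unfold conicOnTorus
  have h : ∀ x y : ℂ, ‖x‖ = 1 → ‖y‖ = 1 →
      ‖y ^ 2 + y * (x + 1) + x ^ 2 + x + 1‖ ≤ 6 := fun x y hx hy => by
    calc ‖y ^ 2 + y * (x + 1) + x ^ 2 + x + 1‖
        ≤ ‖y ^ 2‖ + ‖y * (x + 1)‖ + ‖x ^ 2‖ + ‖x‖ + ‖(1 : ℂ)‖ := by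
          refine (norm_add_le _ _).trans (add_le_add_left ?_ _)
          refine (norm_add_le _ _).trans (add_le_add_left ?_ _)
          refine (norm_add_le _ _).trans (add_le_add_left ?_ _)
          exact norm_add_le _ _
      _ ≤ 1 + 1 * (1 + 1) + 1 + 1 + 1 := by
          have := norm_add_le x 1
          rw [norm_pow, norm_mul, norm_pow, hx, hy, norm_one]
          rw [hx, norm_one] at this
          linarith
      _ = 6 := by norm_num
  exact h _ _ (Complex.norm_exp_ofReal_mul_I θ) (Complex.norm_exp_ofReal_mul_I ψ)

/-- Bounds |log| by an expression affine in log, so a lower bound on ∫ log x controls ∫ |log x|. At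
x = 0 it relies on `Real.log 0 = 0`. -/
theorem abs_log_le_two_mul_log_sub_log {x C : ℝ} (hC : 1 ≤ C) (h0 : 0 ≤ x) (hx : x ≤ C) :
    |Real.log x| ≤ 2 * Real.log C - Real.log x := by
  have hC' := Real.log_nonneg hC
  rcases h0.eq_or_lt with rfl | h0
  · simpa using hC'
  · have := Real.log_le_log h0 hx
    rcases abs_cases (Real.log x) with h | h <;> linarith [h.1]

theorem conicFiberIntegral_eq_integral_Icc (θ : ℝ) :
    conicFiberIntegral θ = ∫ ψ in Set.Icc 0 (2 * Real.pi), Real.log ‖conicOnTorus θ ψ‖ := by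
  rw [integral_Icc_eq_integral_Ioc, conicFiberIntegral,
    intervalIntegral.integral_of_le Real.two_pi_pos.le]

/-- Since |P| ≤ 6 and every fibre integral is nonnegative by Jensen, the fibrewise L¹ norms are
bounded uniformly in θ. -/
theorem integrable_log_norm_conicOnTorus :
    Integrable (fun p : ℝ × ℝ => Real.log ‖conicOnTorus p.1 p.2‖)
      ((volume.restrict (Set.Icc 0 (2 * Real.pi))).prod
        (volume.restrict (Set.Icc 0 (2 * Real.pi)))) := by
  have hm := measurable_log_norm_conicOnTorus
  rw [integrable_prod_iff hm.aestronglyMeasurable]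
  refine ⟨Filter.Eventually.of_forall integrableOn_log_norm_conicOnTorus, ?_⟩
  refine Integrable.of_bound
    (hm.norm.aestronglyMeasurable.integral_prod_right' (f := fun p : ℝ × ℝ => ‖Real.log _‖))
    (2 * Real.log 6 * (2 * Real.pi)) (Filter.Eventually.of_forall fun θ => ?_)
  have hi := integrableOn_log_norm_conicOnTorus θ
  have hc : IntegrableOn (fun _ : ℝ => 2 * Real.log 6) (Set.Icc 0 (2 * Real.pi)) :=
    integrableOn_const measure_Icc_lt_top.ne
  rw [Real.norm_of_nonneg (integral_nonneg fun _ => norm_nonneg _)]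
  calc ∫ ψ in Set.Icc 0 (2 * Real.pi), ‖Real.log ‖conicOnTorus θ ψ‖‖
      ≤ ∫ ψ in Set.Icc 0 (2 * Real.pi), (2 * Real.log 6 - Real.log ‖conicOnTorus θ ψ‖) :=
        integral_mono hi.norm (hc.sub hi) fun ψ =>
          abs_log_le_two_mul_log_sub_log (by norm_num) (norm_nonneg _) (norm_conicOnTorus_le θ ψ)
    _ = 2 * Real.log 6 * (2 * Real.pi) - conicFiberIntegral θ := by
        rw [integral_sub hc hi, ← conicFiberIntegral_eq_integral_Icc, setIntegral_const,
          measureReal_def, Real.volume_Icc, sub_zero, ENNReal.toReal_ofReal Real.two_pi_pos.le,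
          smul_eq_mul, mul_comm (2 * Real.pi)]
    _ ≤ _ := sub_le_self _ (conicFiberIntegral_nonneg θ)

theorem intervalIntegrable_conicFiberIntegral {a b : ℝ} (ha : a ∈ Set.Icc 0 (2 * Real.pi))
    (hb : b ∈ Set.Icc 0 (2 * Real.pi)) : IntervalIntegrable conicFiberIntegral volume a b := by
  have h := integrable_log_norm_conicOnTorus.integral_prod_left
  simp only [← conicFiberIntegral_eq_integral_Icc] at h
  exact (IntegrableOn.mono_set h (Set.uIcc_subset_Icc ha hb)).intervalIntegrable

/-! ### Assembling the integral. -/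

theorem integral_conicFiberIntegral :
    ∫ θ in (0 : ℝ)..(2 * Real.pi), conicFiberIntegral θ =
      8 * Real.pi * (1 / 2 * logTwoSinIntegral (Real.pi / 6) -
        2 * logTwoSinIntegral (Real.pi / 4)) := by
  have hpi := Real.pi_pos
  have mem : ∀ {t : ℝ}, 0 ≤ t → t ≤ 2 * Real.pi → t ∈ Set.Icc 0 (2 * Real.pi) :=
    fun h h' => ⟨h, h'⟩
  have hsymm : ∫ θ in Real.pi..(2 * Real.pi), conicFiberIntegral θ =
      ∫ θ in (0 : ℝ)..Real.pi, conicFiberIntegral θ := by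
    have h := intervalIntegral.integral_comp_sub_left (a := 0) (b := Real.pi) conicFiberIntegral
      (2 * Real.pi)
    simp only [conicFiberIntegral_two_pi_sub, sub_zero] at h
    rw [h]
    congr 1
    ring
  have hscale := intervalIntegral.integral_comp_mul_left (a := 0) (b := Real.pi / 2)
    conicFiberIntegral (two_ne_zero (α := ℝ))
  rw [mul_zero, mul_div_cancel₀ _ (two_ne_zero (α := ℝ)), smul_eq_mul] at hscale
  have hint : ∀ {s t : ℝ}, 0 ≤ s → s ≤ Real.pi → 0 ≤ t → t ≤ Real.pi →
      IntervalIntegrable (fun φ => conicFiberIntegral (2 * φ)) volume s t :=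
    fun {s t} h1 h2 h3 h4 => by
      simpa using (intervalIntegrable_conicFiberIntegral (a := 2 * s) (b := 2 * t)
        (mem (by linarith) (by linarith)) (mem (by linarith) (by linarith))).comp_mul_left (c := 2)
  have p1 : ∫ φ in (0 : ℝ)..(Real.pi / 4), conicFiberIntegral (2 * φ) =
      2 * Real.pi * (-(4 / 3) * logTwoSinIntegral (Real.pi / 4)) := by
    rw [← integral_log_four_mul_cos_sq_sub_one, ← intervalIntegral.integral_const_mul]
    refine intervalIntegral.integral_congr fun φ hφ => ?_
    rw [Set.uIcc_of_le (by positivity)] at hφ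
    exact conicFiberIntegral_two_mul_of_le_pi_div_four hφ
  have p2 : ∫ φ in (Real.pi / 4)..(Real.pi / 3), conicFiberIntegral (2 * φ) = 0 := by
    refine (intervalIntegral.integral_congr (g := fun _ => 0) fun φ hφ => ?_).trans (by simp)
    rw [Set.uIcc_of_le (by linarith)] at hφ
    exact conicFiberIntegral_two_mul_of_mem_Icc hφ
  have p3 : ∫ φ in (Real.pi / 3)..(Real.pi / 2), conicFiberIntegral (2 * φ) =
      2 * Real.pi * (1 / 2 * logTwoSinIntegral (Real.pi / 6) -
        2 / 3 * logTwoSinIntegral (Real.pi / 4)) := by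
    have h := intervalIntegral.integral_comp_sub_left (a := Real.pi / 3) (b := Real.pi / 2)
      (fun u => Real.log (Real.sin u + √(1 - 3 * Real.sin u ^ 2))) (Real.pi / 2)
    simp only [Real.sin_pi_div_two_sub, sub_self] at h
    rw [show Real.pi / 2 - Real.pi / 3 = Real.pi / 6 by ring] at h
    rw [← integral_log_sin_add_sqrt, ← h, ← intervalIntegral.integral_const_mul]
    refine intervalIntegral.integral_congr fun φ hφ => ?_
    rw [Set.uIcc_of_le (by linarith)] at hφ
    exact conicFiberIntegral_two_mul_of_pi_div_three_le hφ
  have q1 := intervalIntegral.integral_add_adjacent_intervals (μ := volume)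
    (f := fun φ => conicFiberIntegral (2 * φ)) (a := 0) (b := Real.pi / 4) (c := Real.pi / 3)
    (hint (by linarith) (by linarith) (by linarith) (by linarith))
    (hint (by linarith) (by linarith) (by linarith) (by linarith))
  have q2 := intervalIntegral.integral_add_adjacent_intervals (μ := volume)
    (f := fun φ => conicFiberIntegral (2 * φ)) (a := 0) (b := Real.pi / 3) (c := Real.pi / 2)
    (hint (by linarith) (by linarith) (by linarith) (by linarith))
    (hint (by linarith) (by linarith) (by linarith) (by linarith))
  have q3 := intervalIntegral.integral_add_adjacent_intervals (μ := volume)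
    (f := conicFiberIntegral) (a := 0) (b := Real.pi) (c := 2 * Real.pi)
    (intervalIntegrable_conicFiberIntegral (mem (by linarith) (by linarith))
      (mem (by linarith) (by linarith)))
    (intervalIntegrable_conicFiberIntegral (mem (by linarith) (by linarith))
      (mem (by linarith) (by linarith)))
  rw [← q3, hsymm]
  linarith

theorem measurePreserving_angleCube_two :
    MeasurePreserving (MeasurableEquiv.finTwoArrow (α := ℝ)) (volume.restrict (angleCube 2))
      ((volume.restrict (Set.Icc 0 (2 * Real.pi))).prod
        (volume.restrict (Set.Icc 0 (2 * Real.pi)))) := by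
  have h := (volume_preserving_finTwoArrow ℝ).restrict_preimage_emb
    (MeasurableEquiv.finTwoArrow (α := ℝ)).measurableEmbedding
    (Set.Icc 0 (2 * Real.pi) ×ˢ Set.Icc 0 (2 * Real.pi))
  rw [Measure.volume_eq_prod, ← Measure.prod_restrict] at h
  have hs : MeasurableEquiv.finTwoArrow ⁻¹'
      (Set.Icc 0 (2 * Real.pi) ×ˢ Set.Icc (0 : ℝ) (2 * Real.pi)) = angleCube 2 := by
    ext θ
    simp only [angleCube, MeasurableEquiv.finTwoArrow, Set.mem_preimage, Set.mem_prod, Set.mem_Icc,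
      Pi.le_def, Fin.forall_fin_two]
    exact and_and_and_comm
  rwa [hs] at h

theorem mainTheorem3 (P : MvPolynomial (Fin 2) ℂ) (ω : ℂ)
    (hP : P = MvPolynomial.X 1 ^ 2 + MvPolynomial.X 1 * (MvPolynomial.X 0 + 1)
      + MvPolynomial.X 0 ^ 2 + MvPolynomial.X 0 + 1)
    (hω : ω = Complex.exp (2 * Real.pi * Complex.I / 3)) :
    IntegrableOn (logNormOnTorus P) (angleCube 2) ∧
      Real.pi * logMahlerMeasure P = 2 * blochWigner Complex.I - 3 / 4 * blochWigner ω := by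
  have hf : logNormOnTorus P = (fun p : ℝ × ℝ => Real.log ‖conicOnTorus p.1 p.2‖) ∘
      MeasurableEquiv.finTwoArrow := by
    funext θ
    simp [hP, logNormOnTorus, conicOnTorus, MeasurableEquiv.finTwoArrow]
  have hmp := measurePreserving_angleCube_two
  have he := (MeasurableEquiv.finTwoArrow (α := ℝ)).measurableEmbedding
  refine ⟨?_, ?_⟩
  · rw [IntegrableOn, hf, hmp.integrable_comp_emb he]
    exact integrable_log_norm_conicOnTorus
  · have hI : ∫ θ in angleCube 2, logNormOnTorus P θ =
        ∫ θ in (0 : ℝ)..(2 * Real.pi), conicFiberIntegral θ := by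
      simp only [hf, Function.comp_apply]
      rw [hmp.integral_comp he (fun p : ℝ × ℝ => Real.log ‖conicOnTorus p.1 p.2‖),
        integral_prod _ integrable_log_norm_conicOnTorus,
        intervalIntegral.integral_of_le Real.two_pi_pos.le, ← integral_Icc_eq_integral_Ioc]
      simp only [conicFiberIntegral_eq_integral_Icc]
    have hpi := Real.pi_pos.ne'
    rw [logMahlerMeasure, hI, integral_conicFiberIntegral, hω, blochWigner_I,
      blochWigner_exp_two_pi_mul_I_div_three]
    field_simp
    linarith [three_mul_logTwoSinIntegral_pi_div_three]
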